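/- There is an absolute constant $C>0$ with the following property. Let $n,m\ge 1$ be integers, let $\mu\in\mathbb{R}^n$, and let $\Sigma_1,\Sigma_2$ be symmetric positive definite $n\times n$ matrices. Write $\lambda_1(A)\ge\lambda_2(A)\ge\cdots$ for the ordered eigenvalues of a symmetric matrix $A$, and suppose that $\lambda_1(\Sigma_i)>\lambda_2(\Sigma_i)$ for $i=1,2$ (no condition if $n=1$) and that, for some $\beta>0$, the vector $2\beta\mu$ is a unit-length eigenvector of both $\Sigma_1$ and $\Sigma_2$ for their respective largest eigenvalues. Let $$X=\theta\mu+g^{(\theta)},$$ where $P(\theta=1)=P(\theta=-1)=\tfrac12$, and $g^{(1)}\sim\mathcal N_n(0,\Sigma_1)$ and $g^{(-1)}\sim\mathcal N_n(0,\Sigma_2)$ are independent of $\theta$; put $\Sigma=E[XX^\top]$. Let $K\ge 1$ be any constant such that $$\|\langle X,x\rangle\|_{\psi_2}\le K\,\|\langle X,x\rangle\|_{L^2}\qquad\text{for all }x\in\mathbb{R}^n,$$ where $\|Y\|_{\psi_2}=\inf\{t>0: E\exp(Y^2/t^2)\le 2\}$. Let $X_1,\dots,X_m$ be i.i.d. copies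 of $X$ and $S_m=\frac1m\sum_{i=1}^m X_iX_i^\top$. Then for every $u\ge 0$, $$P\left(\|S_m-\Sigma\|_{\mathrm{op}}\le C K^2\left(\sqrt{\frac{n+u}{m}}+\frac{n+u}{m}\right)\left(\frac{\lambda_1(\Sigma_1)+\lambda_1(\Sigma_2)}{2}+\|\mu\|_2^2\right)\right)\ge 1-2e^{-u},$$ where $\|\cdot\|_{\mathrm{op}}$ is the operator norm with respect to the Euclidean norm. -/

import Mathlib

open MeasureTheory ProbabilityTheory
open scoped ENNReal RealInnerProductSpace

namespace AllometricMixture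

/-- The sub-gaussian (Orlicz `ψ₂`) norm of a real random variable `Y`:
the infimum of all `t > 0` with `E exp (Y² / t²) ≤ 2`, equal to `∞` if there is no such `t`. -/
noncomputable def psi2Norm {Ω : Type*} [MeasurableSpace Ω] (Y : Ω → ℝ) (P : Measure Ω) : ℝ≥0∞ :=
  ⨅ (t : ℝ) (_ : 0 < t ∧ ∫⁻ ω, ENNReal.ofReal (Real.exp (Y ω ^ 2 / t ^ 2)) ∂P ≤ 2),
    ENNReal.ofReal t

/-- The eigenvalues of a symmetric matrix in decreasing order, with multiplicity. The indices
start from `0`, so that the `k`-th largest eigenvalue is `orderedEigenvalue hA (k - 1)`. -/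
noncomputable def orderedEigenvalue {n : ℕ} {A : Matrix (Fin n) (Fin n) ℝ} (hA : A.IsHermitian)
    (k : Fin n) : ℝ :=
  hA.eigenvalues₀ (Fin.cast (Fintype.card_fin n).symm k)

/-- The largest eigenvalue of a symmetric matrix of positive size. -/
noncomputable def lambda1 {n : ℕ} (hn : 0 < n) {A : Matrix (Fin n) (Fin n) ℝ}
    (hA : A.IsHermitian) : ℝ :=
  orderedEigenvalue hA ⟨0, hn⟩

/-- `v` is a unit-length eigenvector for the largest eigenvalue of the symmetric matrix `A`. -/
def IsLeadingEigenvector {n : ℕ} (hn : 0 < n) {A : Matrix (Fin n) (Fin n) ℝ}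
    (hA : A.IsHermitian) (v : EuclideanSpace ℝ (Fin n)) : Prop :=
  ‖v‖ = 1 ∧ Matrix.toEuclideanCLM (n := Fin n) (𝕜 := ℝ) A v = lambda1 hn hA • v

/-- The parameters of the model: `S₁`, `S₂` are positive definite, their largest eigenvalues are
strictly larger than their second largest ones (void in dimension one), and they have the
common unit-length leading eigenvector `2 β μ` for some `β > 0`. -/
structure IsAllometric {n : ℕ} (hn : 0 < n) (μ : EuclideanSpace ℝ (Fin n))
    (S₁ S₂ : Matrix (Fin n) (Fin n) ℝ) : Prop where
  posDef₁ : S₁.PosDef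
  posDef₂ : S₂.PosDef
  gap₁ : ∀ h : 1 < n, orderedEigenvalue posDef₁.isHermitian ⟨1, h⟩ < lambda1 hn posDef₁.isHermitian
  gap₂ : ∀ h : 1 < n, orderedEigenvalue posDef₂.isHermitian ⟨1, h⟩ < lambda1 hn posDef₂.isHermitian
  leading : ∃ β : ℝ, 0 < β ∧ IsLeadingEigenvector hn posDef₁.isHermitian ((2 * β) • μ) ∧
    IsLeadingEigenvector hn posDef₂.isHermitian ((2 * β) • μ)

/-- `X = θ μ + g^(θ)`, where `θ` is a symmetric Bernoulli variable (with values `1` and `-1`),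
and `g^(1) = g₁ ∼ N(0, S₁)` and `g^(-1) = g₂ ∼ N(0, S₂)` are independent of `θ`. -/
structure IsMixture {Ω : Type*} [MeasurableSpace Ω] {n : ℕ} (P : Measure Ω)
    (μ : EuclideanSpace ℝ (Fin n)) (S₁ S₂ : Matrix (Fin n) (Fin n) ℝ)
    (θ : Ω → ℝ) (g₁ g₂ X : Ω → EuclideanSpace ℝ (Fin n)) : Prop where
  aemeasurable_theta : AEMeasurable θ P
  theta_pos : P {ω | θ ω = 1} = 1 / 2
  theta_neg : P {ω | θ ω = -1} = 1 / 2
  law₁ : HasLaw g₁ (multivariateGaussian 0 S₁) P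
  law₂ : HasLaw g₂ (multivariateGaussian 0 S₂) P
  indep₁ : IndepFun θ g₁ P
  indep₂ : IndepFun θ g₂ P
  eq_mixture : ∀ ω, X ω = θ ω • μ + (if θ ω = 1 then g₁ ω else g₂ ω)

/-- The matrix `E[X Xᵀ]`, the covariance matrix of a centered random vector. -/
noncomputable def covMatrix {Ω : Type*} [MeasurableSpace Ω] {n : ℕ} (P : Measure Ω)
    (X : Ω → EuclideanSpace ℝ (Fin n)) : Matrix (Fin n) (Fin n) ℝ :=
  Matrix.of fun i j => ∫ ω, X ω i * X ω j ∂P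

/-- The sample covariance matrix `m⁻¹ ∑ i, x i (x i)ᵀ` of `m` centered data points. -/
noncomputable def sampleCov {m n : ℕ} (x : Fin m → EuclideanSpace ℝ (Fin n)) :
    Matrix (Fin n) (Fin n) ℝ :=
  (1 / (m : ℝ)) • ∑ i, Matrix.vecMulVec (x i).ofLp (x i).ofLp

/-- The operator norm of a square matrix with respect to the Euclidean norm. -/
noncomputable def opNorm {n : ℕ} (A : Matrix (Fin n) (Fin n) ℝ) : ℝ :=
  ‖Matrix.toEuclideanCLM (n := Fin n) (𝕜 := ℝ) A‖

end AllometricMixture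

/-!
For a unit vector `x`, the quadratic form of `S_m - Σ` at `x` is a centered average of the
independent variables `⟪X_i, x⟫ ^ 2`, whose exponential moments are controlled by the `ψ₂` norm, so
Bernstein's inequality bounds it with probability `1 - 2 exp (-(m r))`. A `1 / 2`-net of the unit
sphere with at most `5 ^ n` points and a union bound make this uniform in `x`: by polarization, the
quadratic form on such a net controls the operator norm. For the mixture,
`Σ = μ μᵀ + (S₁ + S₂) / 2`, so that `‖Σ‖` is at most the factor in the statement.
-/

namespace AllometricMixture

section Subexponential

variable {Ω : Type*} [MeasurableSpace Ω] {P : Measure Ω}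

/-- Sub-exponential random variables: the moment generating function of `X` is at most
`exp (c t² / 2)` for `|t| ≤ b`. It is the analogue on a bounded range of `t` of Mathlib's
`HasSubgaussianMGF`; in the `(ν, α)` parametrization, `c = ν²` and `b = 1 / α`. -/
structure HasSubexponentialMGF (X : Ω → ℝ) (c b : ℝ) (P : Measure Ω) : Prop where
  integrable_exp_mul : ∀ t, |t| ≤ b → Integrable (fun ω => Real.exp (t * X ω)) P
  mgf_le : ∀ t, |t| ≤ b → mgf X P t ≤ Real.exp (c * t ^ 2 / 2)

namespace HasSubexponentialMGF

lemma sum_of_iIndepFun {ι : Type*} {X : ι → Ω → ℝ} (hind : iIndepFun X P)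
    (hXm : ∀ i, AEMeasurable (X i) P) {c : ι → ℝ} {b : ℝ} {s : Finset ι}
    (hX : ∀ i ∈ s, HasSubexponentialMGF (X i) (c i) b P) :
    HasSubexponentialMGF (∑ i ∈ s, X i) (∑ i ∈ s, c i) b P where
  integrable_exp_mul t ht := by
    by_contra hni
    have hzero : mgf (∑ i ∈ s, X i) P t = 0 := integral_undef hni
    have := hind.isProbabilityMeasure
    rw [hind.mgf_sum₀ hXm] at hzero
    exact (Finset.prod_pos fun i hi => mgf_pos ((hX i hi).integrable_exp_mul t ht)).ne' hzero
  mgf_le t ht := by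
    rw [hind.mgf_sum₀ hXm, Finset.sum_mul, Finset.sum_div, Real.exp_sum]
    exact Finset.prod_le_prod (fun i _ => mgf_nonneg) fun i hi => (hX i hi).mgf_le t ht

lemma measureReal_abs_ge_le [IsFiniteMeasure P] {X : Ω → ℝ} {c b : ℝ}
    (hX : HasSubexponentialMGF X c b P) {t : ℝ} (ht0 : 0 ≤ t) (htb : t ≤ b) (ε : ℝ) :
    P.real {ω | ε ≤ |X ω|} ≤ 2 * Real.exp (-(t * ε) + c * t ^ 2 / 2) := by
  have hpos : |t| ≤ b := by rwa [abs_of_nonneg ht0]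
  have hneg : |-t| ≤ b := by rwa [abs_neg]
  have hupper : P.real {ω | ε ≤ X ω} ≤ Real.exp (-(t * ε) + c * t ^ 2 / 2) := by
    rw [Real.exp_add, ← neg_mul]
    exact (measure_ge_le_exp_mul_mgf ε ht0 (hX.integrable_exp_mul t hpos)).trans
      (by gcongr; exact hX.mgf_le t hpos)
  have hlower : P.real {ω | X ω ≤ -ε} ≤ Real.exp (-(t * ε) + c * t ^ 2 / 2) := by
    rw [Real.exp_add, ← neg_sq t, ← mul_neg]
    refine (measure_le_le_exp_mul_mgf (-ε) (neg_nonpos.2 ht0)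
      (hX.integrable_exp_mul (-t) hneg)).trans ?_
    rw [neg_neg]
    gcongr
    exact hX.mgf_le (-t) hneg
  calc P.real {ω | ε ≤ |X ω|} ≤ P.real ({ω | ε ≤ X ω} ∪ {ω | X ω ≤ -ε}) :=
        measureReal_mono fun ω hω => (le_abs.1 hω).elim Or.inl fun h : ε ≤ -X ω =>
          Or.inr (le_neg_of_le_neg h : X ω ≤ -ε)
    _ ≤ P.real {ω | ε ≤ X ω} + P.real {ω | X ω ≤ -ε} := measureReal_union_le _ _
    _ ≤ 2 * Real.exp (-(t * ε) + c * t ^ 2 / 2) := by linarith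

end HasSubexponentialMGF

lemma exp_le_one_add_add_sq_mul_exp_abs (x : ℝ) :
    Real.exp x ≤ 1 + x + x ^ 2 * Real.exp |x| := by
  have h := Complex.norm_exp_sub_sum_le_norm_mul_exp (x : ℂ) 2
  simp only [Finset.sum_range_succ, Finset.sum_range_zero, pow_zero, pow_one, Nat.factorial,
    Nat.cast_one, zero_add, div_one, mul_one] at h
  rw [← Complex.ofReal_exp, ← Complex.ofReal_one, ← Complex.ofReal_add, ← Complex.ofReal_sub,
    Complex.norm_real, Complex.norm_real, Real.norm_eq_abs, Real.norm_eq_abs, sq_abs] at h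
  linarith [le_of_abs_le h]

lemma exp_mul_le_one_add_mul_add {t : ℝ} (ht : |t| ≤ 1 / 2) (x : ℝ) :
    Real.exp (t * x) ≤ 1 + t * x + 8 * t ^ 2 * Real.exp |x| := by
  have hsq : x ^ 2 ≤ 8 * Real.exp (|x| / 2) := by
    have := Real.quadratic_le_exp_of_nonneg (x := |x| / 2) (by positivity)
    nlinarith [sq_abs x, abs_nonneg x]
  have habs : |t * x| ≤ |x| / 2 := by
    rw [abs_mul]
    nlinarith [abs_nonneg x]
  calc Real.exp (t * x) ≤ 1 + t * x + (t * x) ^ 2 * Real.exp |t * x| :=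
        exp_le_one_add_add_sq_mul_exp_abs _
    _ ≤ 1 + t * x + t ^ 2 * (8 * Real.exp (|x| / 2)) * Real.exp (|x| / 2) := by
        rw [mul_pow]
        gcongr
    _ = 1 + t * x + 8 * t ^ 2 * Real.exp |x| := by
        rw [← add_halves |x|, Real.exp_add, add_halves]
        ring

lemma integrable_of_integrable_exp_abs {W : Ω → ℝ} (hWm : AEMeasurable W P)
    (hW : Integrable (fun ω => Real.exp |W ω|) P) : Integrable W P :=
  hW.mono' hWm.aestronglyMeasurable (ae_of_all _ fun ω => by
    rw [Real.norm_eq_abs]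
    linarith [Real.add_one_le_exp |W ω|])

lemma integrable_exp_mul_of_integrable_exp_abs {W : Ω → ℝ} (hWm : AEMeasurable W P)
    (hW : Integrable (fun ω => Real.exp |W ω|) P) {t : ℝ} (ht : |t| ≤ 1) :
    Integrable (fun ω => Real.exp (t * W ω)) P :=
  hW.mono' (hWm.const_mul t).exp.aestronglyMeasurable (ae_of_all _ fun ω => by
    rw [Real.norm_of_nonneg (Real.exp_pos _).le, Real.exp_le_exp]
    calc t * W ω ≤ |t| * |W ω| := (le_abs_self _).trans (abs_mul _ _).le
      _ ≤ |W ω| := mul_le_of_le_one_left (abs_nonneg _) ht)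

variable [IsProbabilityMeasure P]

lemma mgf_le_exp_of_integrable_exp_abs {W : Ω → ℝ} (hWm : AEMeasurable W P)
    (hW : Integrable (fun ω => Real.exp |W ω|) P) {t : ℝ} (ht : |t| ≤ 1 / 2) :
    mgf W P t ≤ Real.exp (t * P[W] + 8 * t ^ 2 * ∫ ω, Real.exp |W ω| ∂P) := by
  have hlin : Integrable (fun ω => t * W ω) P :=
    (integrable_of_integrable_exp_abs hWm hW).const_mul t
  have haff : Integrable (fun ω => 1 + t * W ω) P := (integrable_const 1).add hlin
  calc mgf W P t ≤ ∫ ω, (1 + t * W ω + 8 * t ^ 2 * Real.exp |W ω|) ∂P :=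
        integral_mono (integrable_exp_mul_of_integrable_exp_abs hWm hW (ht.trans (by norm_num)))
          (haff.add (hW.const_mul _)) fun ω => exp_mul_le_one_add_mul_add ht (W ω)
    _ = (t * P[W] + 8 * t ^ 2 * ∫ ω, Real.exp |W ω| ∂P) + 1 := by
        rw [integral_add haff (hW.const_mul _), integral_add (integrable_const 1) hlin,
          integral_const_mul, integral_const_mul, integral_const, probReal_univ, one_smul]
        ring
    _ ≤ _ := Real.add_one_le_exp _

lemma hasSubexponentialMGF_sub_integral {W : Ω → ℝ} (hWm : AEMeasurable W P)
    (hW : Integrable (fun ω => Real.exp |W ω|) P) :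
    HasSubexponentialMGF (fun ω => W ω - P[W]) (16 * ∫ ω, Real.exp |W ω| ∂P) (1 / 2) P where
  integrable_exp_mul t ht := by
    simp only [mul_sub, Real.exp_sub]
    exact (integrable_exp_mul_of_integrable_exp_abs hWm hW (ht.trans (by norm_num))).div_const _
  mgf_le t ht := by
    simp only [sub_eq_add_neg, mgf_add_const]
    calc mgf W P t * Real.exp (t * -P[W])
        ≤ Real.exp (t * P[W] + 8 * t ^ 2 * ∫ ω, Real.exp |W ω| ∂P) * Real.exp (t * -P[W]) := by
          gcongr
          exact mgf_le_exp_of_integrable_exp_abs hWm hW ht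
      _ = Real.exp (16 * (∫ ω, Real.exp |W ω| ∂P) * t ^ 2 / 2) := by
          rw [← Real.exp_add]
          ring_nf

lemma exists_bernstein_exponent {r : ℝ} (hr : 0 ≤ r) :
    ∃ t, 0 ≤ t ∧ t ≤ 1 / 2 ∧ r ≤ t * (17 * (√r + r)) - 16 * t ^ 2 := by
  have hsqrt := Real.sqrt_nonneg r
  have hsq := Real.sq_sqrt hr
  rcases le_total √r (1 / 2) with h | h
  · exact ⟨√r, hsqrt, h, by nlinarith⟩
  · exact ⟨1 / 2, by norm_num, le_rfl, by nlinarith⟩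

lemma measureReal_abs_sum_sub_integral_ge_le {ι : Type*} {W : ι → Ω → ℝ} (hind : iIndepFun W P)
    (hWm : ∀ i, AEMeasurable (W i) P) {s : Finset ι}
    (hW : ∀ i ∈ s, Integrable (fun ω => Real.exp |W i ω|) P)
    (hW2 : ∀ i ∈ s, ∫ ω, Real.exp |W i ω| ∂P ≤ 2) {r : ℝ} (hr : 0 ≤ r) :
    P.real {ω | s.card * (17 * (√r + r)) ≤ |∑ i ∈ s, (W i ω - P[W i])|} ≤
      2 * Real.exp (-(s.card * r)) := by
  have hZind : iIndepFun (fun i ω => W i ω - P[W i]) P :=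
    hind.comp (fun i x => x - ∫ ω, W i ω ∂P) fun i => by fun_prop
  have hZ : HasSubexponentialMGF (∑ i ∈ s, fun ω => W i ω - P[W i])
      (∑ i ∈ s, 16 * ∫ ω, Real.exp |W i ω| ∂P) (1 / 2) P :=
    .sum_of_iIndepFun hZind (fun i => (hWm i).sub_const _) fun i hi =>
      hasSubexponentialMGF_sub_integral (hWm i) (hW i hi)
  have hvar : ∑ i ∈ s, 16 * ∫ ω, Real.exp |W i ω| ∂P ≤ s.card * 32 := by
    rw [← nsmul_eq_mul]
    exact Finset.sum_le_card_nsmul s _ _ fun i hi => by linarith [hW2 i hi]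
  obtain ⟨t, ht0, ht_half, ht⟩ := exists_bernstein_exponent hr
  have htail := hZ.measureReal_abs_ge_le ht0 ht_half (s.card * (17 * (√r + r)))
  simp only [Finset.sum_apply] at htail
  refine htail.trans ?_
  gcongr
  nlinarith [mul_le_mul_of_nonneg_right hvar (sq_nonneg t),
    mul_le_mul_of_nonneg_left ht (Nat.cast_nonneg (α := ℝ) s.card)]

end Subexponential

section Nets

open Metric

lemma encard_le_pow_finrank_of_isSeparated {E : Type*} [NormedAddCommGroup E] [NormedSpace ℝ E]
    [FiniteDimensional ℝ E] {s : Set E} (hs : s ⊆ closedBall 0 1) (hsep : IsSeparated (1 / 2) s) :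
    s.encard ≤ 5 ^ Module.finrank ℝ E := by
  classical
  by_contra! hcard
  obtain ⟨t, hts, ht⟩ := Set.exists_subset_encard_eq (Order.add_one_le_of_lt hcard)
  have htfin : t.Finite := Set.finite_of_encard_eq_coe ht
  lift t to Finset E using htfin
  have hscale : Function.Injective fun x : E => (2 : ℝ) • x := smul_right_injective E two_ne_zero
  have hle := Besicovitch.card_le_of_separated (t.image fun x : E => (2 : ℝ) • x)
    (Finset.forall_mem_image.2 fun y hy => by
      have := mem_closedBall_zero_iff.1 (hs (hts hy))
      rw [norm_smul, Real.norm_ofNat]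
      linarith)
    (Finset.forall_mem_image.2 fun c hc => Finset.forall_mem_image.2 fun d hd hne => by
      have hcd : (1 / 2 : ℝ) < dist c d := by
        have : 1 / 2 < edist c d := hsep (hts hc) (hts hd) (ne_of_apply_ne _ hne)
        rw [edist_dist, ENNReal.lt_ofReal_iff_toReal_lt (by finiteness)] at this
        simpa using this
      rw [← smul_sub, norm_smul, Real.norm_ofNat, ← dist_eq_norm]
      linarith)
  rw [Finset.card_image_of_injective t hscale] at hle
  rw [Set.encard_coe_eq_coe_finsetCard] at ht
  norm_cast at ht
  omega

lemma exists_finset_isCover_sphere (E : Type*) [NormedAddCommGroup E] [NormedSpace ℝ E]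
    [FiniteDimensional ℝ E] :
    ∃ N : Finset E, N.card ≤ 5 ^ Module.finrank ℝ E ∧ (N : Set E) ⊆ sphere 0 1 ∧
      IsCover (1 / 2) (sphere 0 1) (N : Set E) := by
  have hpack : packingNumber (1 / 2) (sphere (0 : E) 1) ≤ 5 ^ Module.finrank ℝ E :=
    iSup₂_le fun s hs => iSup_le fun hsep =>
      encard_le_pow_finrank_of_isSeparated (hs.trans sphere_subset_closedBall) (by simpa using hsep)
  have hcov := (coveringNumber_le_packingNumber (1 / 2) (sphere (0 : E) 1)).trans hpack
  have hfinite : coveringNumber (1 / 2) (sphere (0 : E) 1) ≠ ⊤ :=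
    ne_top_of_le_ne_top (by exact_mod_cast ENat.natCast_ne_top _) hcov
  obtain ⟨N, hN, hfin, hNcover, hcard⟩ := exists_set_encard_eq_coveringNumber hfinite
  lift N to Finset E using hfin
  rw [← hcard, Set.encard_coe_eq_coe_finsetCard] at hcov
  exact ⟨N, by exact_mod_cast hcov, hN, hNcover⟩

lemma norm_add_mul_norm_sub_le (𝕜 : Type*) {E : Type*} [RCLike 𝕜] [NormedAddCommGroup E]
    [InnerProductSpace 𝕜 E] {x y : E} (hx : ‖x‖ = 1) (hy : ‖y‖ = 1) (hxy : ‖x - y‖ ≤ 1 / 2) :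
    ‖x + y‖ * ‖x - y‖ ≤ 31 / 32 := by
  have hpar := parallelogram_law_with_norm 𝕜 x y
  rw [hx, hy] at hpar
  have hdist : ‖x - y‖ ^ 2 ≤ 1 / 4 := by nlinarith [norm_nonneg (x - y)]
  have hsq : (‖x + y‖ * ‖x - y‖) ^ 2 ≤ (31 / 32) ^ 2 :=
    calc (‖x + y‖ * ‖x - y‖) ^ 2 = (4 - ‖x - y‖ ^ 2) * ‖x - y‖ ^ 2 := by
          linear_combination ‖x - y‖ ^ 2 * hpar
      -- `(4 - d²) d²` increases with `d` on `[0, 1/2]`, up to `15 / 16`.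
      _ ≤ (31 / 32) ^ 2 := by nlinarith
  exact (abs_le_of_sq_le_sq' hsq (by norm_num)).2

variable {𝕜 E : Type*} [RCLike 𝕜] [NormedAddCommGroup E] [InnerProductSpace 𝕜 E]
  {T : E →L[𝕜] E}

lemma opNorm_le_of_abs_reApplyInnerSelf_le (hT : (T : E →ₗ[𝕜] E).IsSymmetric) {M : ℝ}
    (hM : 0 ≤ M) (h : ∀ x ∈ sphere (0 : E) 1, |T.reApplyInnerSelf x| ≤ M) : ‖T‖ ≤ M := by
  refine (T.norm_eq_iSup_rayleighQuotient hT).le.trans (ciSup_le fun x => ?_)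
  rcases eq_or_ne x 0 with rfl | hx
  · simpa [ContinuousLinearMap.rayleighQuotient] using hM
  · have hunit : ‖((‖x‖⁻¹ : ℝ) : 𝕜) • x‖ = 1 := by simp [norm_smul, hx]
    have := h _ (mem_sphere_zero_iff_norm.2 hunit)
    rw [← T.rayleigh_smul x (c := ((‖x‖⁻¹ : ℝ) : 𝕜)) (by simpa using hx),
      ContinuousLinearMap.rayleighQuotient, hunit, one_pow, div_one]
    exact this

lemma re_inner_map_add_sub_eq (hT : (T : E →ₗ[𝕜] E).IsSymmetric) (x y : E) :
    RCLike.re (inner 𝕜 (T (x + y)) (x - y)) = T.reApplyInnerSelf x - T.reApplyInnerSelf y := by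
  have hxy : RCLike.re (inner 𝕜 (T x) y) = RCLike.re (inner 𝕜 (T y) x) := by
    rw [← inner_conj_symm, RCLike.conj_re, ← hT.apply_clm]
  simp only [ContinuousLinearMap.reApplyInnerSelf_apply, map_add, inner_add_left, inner_sub_right,
    map_sub]
  linarith

lemma opNorm_le_of_isCover_half (hT : (T : E →ₗ[𝕜] E).IsSymmetric) {N : Set E}
    (hN : N ⊆ sphere 0 1) (hcover : IsCover (1 / 2) (sphere 0 1) N) {δ : ℝ} (hδ : 0 ≤ δ)
    (h : ∀ y ∈ N, |T.reApplyInnerSelf y| ≤ δ) : ‖T‖ ≤ 32 * δ := by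
  have hself : ‖T‖ ≤ δ + 31 / 32 * ‖T‖ := by
    refine opNorm_le_of_abs_reApplyInnerSelf_le hT (by positivity) fun x hx => ?_
    obtain ⟨y, hy, hxy⟩ := hcover hx
    have hdist : ‖x - y‖ ≤ 1 / 2 := by
      have : edist x y ≤ (1 / 2 : NNReal) := hxy
      rwa [edist_le_coe, ← NNReal.coe_le_coe, coe_nndist, dist_eq_norm, NNReal.coe_div,
        NNReal.coe_one, NNReal.coe_ofNat] at this
    have hprod := norm_add_mul_norm_sub_le 𝕜 (mem_sphere_zero_iff_norm.1 hx)
      (mem_sphere_zero_iff_norm.1 (hN hy)) hdist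
    calc |T.reApplyInnerSelf x|
        = |T.reApplyInnerSelf y + RCLike.re (inner 𝕜 (T (x + y)) (x - y))| := by
          rw [re_inner_map_add_sub_eq hT]
          ring_nf
      _ ≤ |T.reApplyInnerSelf y| + ‖T (x + y)‖ * ‖x - y‖ :=
          (abs_add_le _ _).trans
            (by gcongr; exact (RCLike.abs_re_le_norm _).trans (norm_inner_le_norm _ _))
      _ ≤ δ + ‖T‖ * (‖x + y‖ * ‖x - y‖) := by
          rw [← mul_assoc]
          gcongr
          exacts [h y hy, T.le_opNorm _]
      _ ≤ δ + 31 / 32 * ‖T‖ := by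
          rw [mul_comm (31 / 32)]
          gcongr
  linarith

end Nets

section Matrices

open InnerProductSpace
open scoped Matrix.Norms.L2Operator

lemma l2_opNorm_eq_norm_eigenvalues {𝕜 ι : Type*} [RCLike 𝕜] [Fintype ι] [DecidableEq ι]
    {A : Matrix ι ι 𝕜} (hA : A.IsHermitian) : ‖A‖ = ‖hA.eigenvalues‖ := by
  calc ‖A‖ = ‖(RCLike.ofReal ∘ hA.eigenvalues : ι → 𝕜)‖ := by
        conv_lhs => rw [hA.spectral_theorem, Unitary.conjStarAlgAut_apply, ← Unitary.coe_star]
        rw [CStarRing.norm_mul_coe_unitary, CStarRing.norm_coe_unitary_mul,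
          Matrix.l2_opNorm_diagonal]
    _ = ‖hA.eigenvalues‖ := by simp [Pi.norm_def]

variable {n : ℕ}

lemma toEuclideanCLM_vecMulVec (x y : EuclideanSpace ℝ (Fin n)) :
    Matrix.toEuclideanCLM (n := Fin n) (𝕜 := ℝ) (Matrix.vecMulVec x.ofLp y.ofLp) =
      rankOne ℝ x y := by
  ext z i
  simp [Matrix.ofLp_toEuclideanCLM, Matrix.vecMulVec_mulVec,
    EuclideanSpace.inner_eq_star_dotProduct, dotProduct_comm, mul_comm]

lemma opNorm_vecMulVec_self (x : EuclideanSpace ℝ (Fin n)) :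
    opNorm (Matrix.vecMulVec x.ofLp x.ofLp) = ‖x‖ ^ 2 := by
  rw [opNorm, toEuclideanCLM_vecMulVec, norm_rankOne, sq]

lemma opNorm_add_le (A B : Matrix (Fin n) (Fin n) ℝ) : opNorm (A + B) ≤ opNorm A + opNorm B := by
  rw [opNorm, map_add]
  exact norm_add_le _ _

lemma opNorm_smul (c : ℝ) (A : Matrix (Fin n) (Fin n) ℝ) : opNorm (c • A) = |c| * opNorm A := by
  rw [opNorm, map_smul, norm_smul, Real.norm_eq_abs, opNorm]

lemma opNorm_le_lambda1 (hn : 0 < n) {A : Matrix (Fin n) (Fin n) ℝ} (hA : A.PosSemidef) :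
    opNorm A ≤ lambda1 hn hA.isHermitian := by
  have hle : ∀ i, hA.isHermitian.eigenvalues i ≤ lambda1 hn hA.isHermitian := fun i =>
    hA.isHermitian.eigenvalues₀_antitone (Fin.le_def.2 (Nat.zero_le _))
  rw [opNorm, Matrix.l2_opNorm_toEuclideanCLM, l2_opNorm_eq_norm_eigenvalues hA.isHermitian,
    pi_norm_le_iff_of_nonneg ((hA.eigenvalues_nonneg ⟨0, hn⟩).trans (hle _))]
  intro i
  rw [Real.norm_of_nonneg (hA.eigenvalues_nonneg i)]
  exact hle i

lemma reApplyInnerSelf_toEuclideanCLM (A : Matrix (Fin n) (Fin n) ℝ)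
    (x : EuclideanSpace ℝ (Fin n)) :
    (Matrix.toEuclideanCLM (n := Fin n) (𝕜 := ℝ) A).reApplyInnerSelf x =
      ∑ i, ∑ j, x i * x j * A i j := by
  rw [ContinuousLinearMap.reApplyInnerSelf_apply, RCLike.re_to_real, real_inner_comm,
    Matrix.inner_toEuclideanCLM]
  simp only [dotProduct, Matrix.mulVec, Finset.mul_sum]
  exact Finset.sum_congr rfl fun i _ => Finset.sum_congr rfl fun j _ => by ring

lemma inner_sq_eq_sum (y x : EuclideanSpace ℝ (Fin n)) :
    ⟪y, x⟫ ^ 2 = ∑ i, ∑ j, x i * x j * (y i * y j) := by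
  rw [sq, PiLp.inner_apply, Finset.sum_mul_sum]
  refine Finset.sum_congr rfl fun i _ => Finset.sum_congr rfl fun j _ => ?_
  simp only [RCLike.inner_apply, conj_trivial]
  ring

variable {Ω : Type*} [MeasurableSpace Ω] {P : Measure Ω} {X : Ω → EuclideanSpace ℝ (Fin n)}

lemma isHermitian_covMatrix : (covMatrix P X).IsHermitian := by
  ext i j
  simp [covMatrix, mul_comm]

lemma isHermitian_sampleCov {m : ℕ} (y : Fin m → EuclideanSpace ℝ (Fin n)) :
    (sampleCov y).IsHermitian := by
  ext i j
  simp [sampleCov, Matrix.sum_apply, Matrix.vecMulVec_apply, mul_comm]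

lemma reApplyInnerSelf_covMatrix (hX : MemLp X 2 P) (x : EuclideanSpace ℝ (Fin n)) :
    (Matrix.toEuclideanCLM (n := Fin n) (𝕜 := ℝ) (covMatrix P X)).reApplyInnerSelf x =
      ∫ ω, ⟪X ω, x⟫ ^ 2 ∂P := by
  have hint : ∀ i j, Integrable (fun ω => x i * x j * (X ω i * X ω j)) P := fun i j =>
    ((MemLp.eval_piLp hX i).integrable_mul (MemLp.eval_piLp hX j)).const_mul _
  simp_rw [reApplyInnerSelf_toEuclideanCLM, inner_sq_eq_sum, covMatrix, Matrix.of_apply]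
  rw [integral_finsetSum _ fun i _ => integrable_finsetSum _ fun j _ => hint i j]
  refine Finset.sum_congr rfl fun i _ => ?_
  rw [integral_finsetSum _ fun j _ => hint i j]
  exact Finset.sum_congr rfl fun j _ => (integral_const_mul _ _).symm

lemma reApplyInnerSelf_sampleCov {m : ℕ} (y : Fin m → EuclideanSpace ℝ (Fin n))
    (x : EuclideanSpace ℝ (Fin n)) :
    (Matrix.toEuclideanCLM (n := Fin n) (𝕜 := ℝ) (sampleCov y)).reApplyInnerSelf x =
      (1 / m : ℝ) * ∑ k, ⟪y k, x⟫ ^ 2 := by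
  simp only [ContinuousLinearMap.reApplyInnerSelf_apply, RCLike.re_to_real, sampleCov, map_smul,
    map_sum, smul_apply, sum_apply, toEuclideanCLM_vecMulVec, rankOne_apply, real_inner_smul_left,
    sum_inner, sq]

end Matrices

section Psi2

variable {Ω Ω' : Type*} [MeasurableSpace Ω] [MeasurableSpace Ω'] {P : Measure Ω} {P' : Measure Ω'}

lemma psi2Norm_eq_of_identDistrib {Y : Ω → ℝ} {Y' : Ω' → ℝ} (h : IdentDistrib Y Y' P P') :
    psi2Norm Y P = psi2Norm Y' P' := by
  have hexp : ∀ t : ℝ, ∫⁻ ω, ENNReal.ofReal (Real.exp (Y ω ^ 2 / t ^ 2)) ∂P =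
      ∫⁻ ω, ENNReal.ofReal (Real.exp (Y' ω ^ 2 / t ^ 2)) ∂P' := fun t =>
    (h.comp (u := fun y => ENNReal.ofReal (Real.exp (y ^ 2 / t ^ 2))) (by fun_prop)).lintegral_eq
  simp_rw [psi2Norm, hexp]

variable {Y : Ω → ℝ} {T : ℝ}

lemma lintegral_exp_sq_le_of_psi2Norm_lt (h : psi2Norm Y P < ENNReal.ofReal T) :
    ∫⁻ ω, ENNReal.ofReal (Real.exp (Y ω ^ 2 / T ^ 2)) ∂P ≤ 2 := by
  obtain ⟨t, ht⟩ := iInf_lt_iff.1 h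
  obtain ⟨⟨ht0, hle⟩, htT⟩ := iInf_lt_iff.1 ht
  have : t < T := (ENNReal.ofReal_lt_ofReal_iff_of_nonneg ht0.le).1 htT
  exact (lintegral_mono fun ω => by gcongr).trans hle

lemma integrable_exp_sq_of_psi2Norm_lt (hY : AEMeasurable Y P)
    (h : psi2Norm Y P < ENNReal.ofReal T) :
    Integrable (fun ω => Real.exp (Y ω ^ 2 / T ^ 2)) P := by
  refine ⟨((hY.pow_const 2).div_const _).exp.aestronglyMeasurable, ?_⟩
  rw [hasFiniteIntegral_iff_ofReal (ae_of_all _ fun ω => (Real.exp_pos _).le)]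
  exact (lintegral_exp_sq_le_of_psi2Norm_lt h).trans_lt ENNReal.ofNat_lt_top

lemma integral_exp_sq_le_of_psi2Norm_lt (hY : AEMeasurable Y P)
    (h : psi2Norm Y P < ENNReal.ofReal T) : ∫ ω, Real.exp (Y ω ^ 2 / T ^ 2) ∂P ≤ 2 := by
  rw [integral_eq_lintegral_of_nonneg_ae (ae_of_all _ fun ω => (Real.exp_pos _).le)
    (integrable_exp_sq_of_psi2Norm_lt hY h).aestronglyMeasurable]
  exact ENNReal.toReal_le_of_le_ofReal zero_le_two
    (by simpa using lintegral_exp_sq_le_of_psi2Norm_lt h)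

end Psi2

section Concentration

lemma measureReal_lt_le_of_tendsto {Ω : Type*} [MeasurableSpace Ω] {P : Measure Ω}
    [IsFiniteMeasure P] {f : Ω → ℝ} {a : ℕ → ℝ} {b δ : ℝ}
    (ha : Antitone a) (hab : Filter.Tendsto a Filter.atTop (nhds b))
    (h : ∀ k, P.real {ω | a k < f ω} ≤ δ) :
    P.real {ω | b < f ω} ≤ δ := by
  have hmono : Monotone fun k => {ω | a k < f ω} := fun i j hij ω hω => (ha hij).trans_lt hω
  have hsub : {ω | b < f ω} ⊆ ⋃ k, {ω | a k < f ω} := fun ω hω =>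
    Set.mem_iUnion.2 (hab.eventually_lt_const hω).exists
  have hδ : 0 ≤ δ := measureReal_nonneg.trans (h 0)
  refine ENNReal.toReal_le_of_le_ofReal hδ ((measure_mono hsub).trans ?_)
  rw [hmono.measure_iUnion]
  exact iSup_le fun k => (ENNReal.le_ofReal_iff_toReal_le (measure_ne_top _ _) hδ).2 (h k)

lemma five_pow_mul_exp_le (n : ℕ) {u : ℝ} (hu : 0 ≤ u) :
    5 ^ n * Real.exp (-(2 * (n + u))) ≤ Real.exp (-u) := by
  have hfive : (5 : ℝ) ≤ Real.exp 2 := by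
    linarith [Real.quadratic_le_exp_of_nonneg (x := 2) zero_le_two]
  calc 5 ^ n * Real.exp (-(2 * (n + u))) ≤ Real.exp 2 ^ n * Real.exp (-(2 * (n + u))) := by gcongr
    _ = Real.exp (-(2 * u)) := by
        rw [← Real.exp_nat_mul, ← Real.exp_add]
        ring_nf
    _ ≤ Real.exp (-u) := Real.exp_le_exp.2 (by linarith)

variable {Ω₀ Ω : Type*} [MeasurableSpace Ω₀] [MeasurableSpace Ω] {P₀ : Measure Ω₀} {P : Measure Ω}
  [IsProbabilityMeasure P] {n m : ℕ} {X : Ω₀ → EuclideanSpace ℝ (Fin n)}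
  {Xs : Fin m → Ω → EuclideanSpace ℝ (Fin n)} {T r : ℝ}

lemma reApplyInnerSelf_sampleCov_sub_covMatrix (hm : 0 < m) (hX : MemLp X 2 P₀)
    (y : Fin m → EuclideanSpace ℝ (Fin n)) (x : EuclideanSpace ℝ (Fin n)) :
    (Matrix.toEuclideanCLM (n := Fin n) (𝕜 := ℝ)
        (sampleCov y - covMatrix P₀ X)).reApplyInnerSelf x =
      (1 / m : ℝ) * ∑ i, (⟪y i, x⟫ ^ 2 - ∫ ω, ⟪X ω, x⟫ ^ 2 ∂P₀) := by
  have hm' : (m : ℝ) ≠ 0 := by exact_mod_cast hm.ne'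
  rw [ContinuousLinearMap.reApplyInnerSelf_apply, map_sub, sub_apply, inner_sub_left, map_sub,
    ← ContinuousLinearMap.reApplyInnerSelf_apply, ← ContinuousLinearMap.reApplyInnerSelf_apply,
    reApplyInnerSelf_sampleCov, reApplyInnerSelf_covMatrix hX, Finset.sum_sub_distrib,
    Finset.sum_const, Finset.card_univ, Fintype.card_fin, nsmul_eq_mul, mul_sub, ← mul_assoc,
    one_div_mul_cancel hm', one_mul]

lemma measureReal_abs_reApplyInnerSelf_ge_le (hm : 0 < m) (hX : MemLp X 2 P₀)
    (hind : iIndepFun Xs P) (hid : ∀ i, IdentDistrib (Xs i) X P P₀) (hT : 0 < T)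
    {x : EuclideanSpace ℝ (Fin n)} (hpsi : psi2Norm (fun ω => ⟪X ω, x⟫) P₀ < ENNReal.ofReal T)
    (hr : 0 ≤ r) :
    P.real {ω | T ^ 2 * (17 * (√r + r)) ≤ |(Matrix.toEuclideanCLM (n := Fin n) (𝕜 := ℝ)
        (sampleCov (fun i => Xs i ω) - covMatrix P₀ X)).reApplyInnerSelf x|} ≤
      2 * Real.exp (-(m * r)) := by
  have hf : Measurable fun y : EuclideanSpace ℝ (Fin n) => ⟪y, x⟫ := by fun_prop
  have hidx : ∀ i, IdentDistrib (fun ω => ⟪Xs i ω, x⟫) (fun ω => ⟪X ω, x⟫) P P₀ :=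
    fun i => (hid i).comp hf
  have hpsis : ∀ i, psi2Norm (fun ω => ⟪Xs i ω, x⟫) P < ENNReal.ofReal T :=
    fun i => (psi2Norm_eq_of_identDistrib (hidx i)).trans_lt hpsi
  have hmeas : ∀ i, AEMeasurable (fun ω => ⟪Xs i ω, x⟫) P := fun i => (hidx i).aemeasurable_fst
  have hmean : ∀ i, ∫ ω, ⟪Xs i ω, x⟫ ^ 2 / T ^ 2 ∂P = (∫ ω, ⟪X ω, x⟫ ^ 2 ∂P₀) / T ^ 2 := fun i =>
    (((hidx i).comp (u := fun z => z ^ 2 / T ^ 2) (by fun_prop)).integral_eq).trans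
      (integral_div _ _)
  have habs : ∀ y : EuclideanSpace ℝ (Fin n), |⟪y, x⟫ ^ 2 / T ^ 2| = ⟪y, x⟫ ^ 2 / T ^ 2 :=
    fun y => abs_of_nonneg (by positivity)
  have hbernstein := measureReal_abs_sum_sub_integral_ge_le (s := Finset.univ)
    (hind.comp (fun _ y => ⟪y, x⟫ ^ 2 / T ^ 2) fun _ => by fun_prop)
    (fun i => ((hmeas i).pow_const 2).div_const _)
    (fun i _ => by
      simpa only [Function.comp_apply, habs] using
        integrable_exp_sq_of_psi2Norm_lt (hmeas i) (hpsis i))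
    (fun i _ => by
      simpa only [Function.comp_apply, habs] using
        integral_exp_sq_le_of_psi2Norm_lt (hmeas i) (hpsis i)) hr
  simp only [Finset.card_univ, Fintype.card_fin, Function.comp_apply, hmean, ← sub_div,
    ← Finset.sum_div] at hbernstein
  refine (measureReal_mono fun ω hω => ?_).trans hbernstein
  rw [Set.mem_ofPred_eq, reApplyInnerSelf_sampleCov_sub_covMatrix hm hX, abs_mul,
    abs_of_pos (by positivity), one_div, ← div_eq_inv_mul, le_div_iff₀ (by positivity)] at hω
  rw [Set.mem_ofPred_eq, abs_div, abs_of_pos (by positivity : (0 : ℝ) < T ^ 2),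
    le_div_iff₀ (by positivity)]
  linarith

lemma measureReal_lt_opNorm_sampleCov_sub_covMatrix_le (hm : 0 < m) (hX : MemLp X 2 P₀)
    (hind : iIndepFun Xs P) (hid : ∀ i, IdentDistrib (Xs i) X P P₀) (hT : 0 < T)
    (hpsi : ∀ x : EuclideanSpace ℝ (Fin n), ‖x‖ = 1 →
      psi2Norm (fun ω => ⟪X ω, x⟫) P₀ < ENNReal.ofReal T) (hr : 0 ≤ r) :
    P.real {ω | 32 * (T ^ 2 * (17 * (√r + r))) <
        opNorm (sampleCov (fun i => Xs i ω) - covMatrix P₀ X)} ≤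
      5 ^ n * (2 * Real.exp (-(m * r))) := by
  obtain ⟨N, hcard, hsphere, hcover⟩ := exists_finset_isCover_sphere (EuclideanSpace ℝ (Fin n))
  rw [finrank_euclideanSpace_fin] at hcard
  have hunion : {ω | 32 * (T ^ 2 * (17 * (√r + r))) <
        opNorm (sampleCov (fun i => Xs i ω) - covMatrix P₀ X)} ⊆
      ⋃ y ∈ N, {ω | T ^ 2 * (17 * (√r + r)) ≤ |(Matrix.toEuclideanCLM (n := Fin n) (𝕜 := ℝ)
        (sampleCov (fun i => Xs i ω) - covMatrix P₀ X)).reApplyInnerSelf y|} := by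
    intro ω hω
    by_contra hnot
    simp only [Set.mem_iUnion, Set.mem_ofPred_eq, not_exists, not_le] at hnot
    refine hω.not_ge (opNorm_le_of_isCover_half ?_ hsphere hcover (by positivity) fun y hy =>
      (hnot y hy).le)
    exact Matrix.isSymmetric_toEuclideanLin_iff.mpr
      ((isHermitian_sampleCov _).sub isHermitian_covMatrix)
  calc P.real {ω | 32 * (T ^ 2 * (17 * (√r + r))) <
        opNorm (sampleCov (fun i => Xs i ω) - covMatrix P₀ X)}
      ≤ ∑ y ∈ N, P.real {ω | T ^ 2 * (17 * (√r + r)) ≤ |(Matrix.toEuclideanCLM (n := Fin n)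
          (𝕜 := ℝ) (sampleCov (fun i => Xs i ω) - covMatrix P₀ X)).reApplyInnerSelf y|} :=
        (measureReal_mono hunion (measure_ne_top _ _)).trans (measureReal_biUnion_finset_le _ _)
    _ ≤ ∑ _y ∈ N, 2 * Real.exp (-(m * r)) := Finset.sum_le_sum fun y hy =>
        measureReal_abs_reApplyInnerSelf_ge_le hm hX hind hid hT
          (hpsi y (mem_sphere_zero_iff_norm.1 (hsphere hy))) hr
    _ ≤ 5 ^ n * (2 * Real.exp (-(m * r))) := by
        rw [Finset.sum_const, nsmul_eq_mul]
        gcongr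
        exact_mod_cast hcard

lemma measureReal_lt_opNorm_sampleCov_sub_covMatrix_le_of_psi2Norm_le (hm : 0 < m)
    (hX : MemLp X 2 P₀) (hind : iIndepFun Xs P) (hid : ∀ i, IdentDistrib (Xs i) X P P₀)
    (hT : 0 ≤ T) (hpsi : ∀ x : EuclideanSpace ℝ (Fin n), ‖x‖ = 1 →
      psi2Norm (fun ω => ⟪X ω, x⟫) P₀ ≤ ENNReal.ofReal T) (hr : 0 ≤ r) :
    P.real {ω | 32 * (T ^ 2 * (17 * (√r + r))) <
        opNorm (sampleCov (fun i => Xs i ω) - covMatrix P₀ X)} ≤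
      5 ^ n * (2 * Real.exp (-(m * r))) := by
  -- Approaching `T` from above covers `T = 0` as well as an unattained infimum in `psi2Norm`.
  have hlim : Filter.Tendsto (fun k : ℕ => T + 1 / ((k : ℝ) + 1)) Filter.atTop (nhds T) := by
    simpa only [add_zero] using tendsto_one_div_add_atTop_nhds_zero_nat.const_add T
  refine measureReal_lt_le_of_tendsto
    (a := fun k : ℕ => 32 * ((T + 1 / ((k : ℝ) + 1)) ^ 2 * (17 * (√r + r))))
    (fun i j hij => ?_) (((hlim.pow 2).mul_const _).const_mul _) fun k => ?_
  · dsimp only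
    gcongr
  · have hk : (0 : ℝ) < 1 / ((k : ℝ) + 1) := by positivity
    exact measureReal_lt_opNorm_sampleCov_sub_covMatrix_le hm hX hind hid (by linarith)
      (fun x hx => (hpsi x hx).trans_lt
        ((ENNReal.ofReal_lt_ofReal_iff (by linarith)).2 (by linarith))) hr

lemma eLpNorm_inner_le_sqrt_opNorm_covMatrix (hX : MemLp X 2 P₀) {x : EuclideanSpace ℝ (Fin n)}
    (hx : ‖x‖ = 1) :
    eLpNorm (fun ω => ⟪X ω, x⟫) 2 P₀ ≤ ENNReal.ofReal √(opNorm (covMatrix P₀ X)) := by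
  have hXx : MemLp (fun ω => ⟪X ω, x⟫) 2 P₀ := hX.inner_const x
  have hquad : ∫ ω, ⟪X ω, x⟫ ^ 2 ∂P₀ ≤ opNorm (covMatrix P₀ X) := by
    rw [← reApplyInnerSelf_covMatrix hX, ContinuousLinearMap.reApplyInnerSelf_apply]
    refine (re_inner_le_norm _ _).trans ?_
    simpa only [hx, mul_one, opNorm] using
      mul_le_mul_of_nonneg_right (ContinuousLinearMap.le_opNorm _ x) (norm_nonneg x)
  rw [hXx.eLpNorm_eq_integral_rpow_norm two_ne_zero ENNReal.ofNat_ne_top]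
  refine ENNReal.ofReal_le_ofReal ?_
  simp only [ENNReal.toReal_ofNat, Real.rpow_two, Real.norm_eq_abs, sq_abs]
  rw [← one_div, ← Real.sqrt_eq_rpow]
  exact Real.sqrt_le_sqrt hquad

theorem le_measureReal_opNorm_sampleCov_sub_covMatrix_le (hm : 0 < m) (hX : MemLp X 2 P₀)
    (hind : iIndepFun Xs P) (hid : ∀ i, IdentDistrib (Xs i) X P P₀) {K u : ℝ} (hK : 0 ≤ K)
    (hpsi : ∀ x : EuclideanSpace ℝ (Fin n), psi2Norm (fun ω => ⟪X ω, x⟫) P₀ ≤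
      ENNReal.ofReal K * eLpNorm (fun ω => ⟪X ω, x⟫) 2 P₀) (hu : 0 ≤ u) :
    1 - 2 * Real.exp (-u) ≤
      P.real {ω | opNorm (sampleCov (fun i => Xs i ω) - covMatrix P₀ X) ≤
        1088 * K ^ 2 * (√((n + u) / m) + (n + u) / m) * opNorm (covMatrix P₀ X)} := by
  set q : ℝ := (n + u) / m with hq
  have hq0 : 0 ≤ q := by positivity
  have hbad := measureReal_lt_opNorm_sampleCov_sub_covMatrix_le_of_psi2Norm_le hm hX hind hid
    (T := K * √(opNorm (covMatrix P₀ X))) (by positivity) (fun x hx => (hpsi x).trans (by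
      rw [ENNReal.ofReal_mul hK]
      gcongr
      exact eLpNorm_inner_le_sqrt_opNorm_covMatrix hX hx)) (mul_nonneg zero_le_two hq0)
  have hprob : 5 ^ n * (2 * Real.exp (-(m * (2 * q)))) ≤ 2 * Real.exp (-u) := by
    have : (m : ℝ) * (2 * q) = 2 * (n + u) := by rw [hq]; field_simp
    rw [this]
    linarith [five_pow_mul_exp_le n hu]
  have hthreshold : 32 * ((K * √(opNorm (covMatrix P₀ X))) ^ 2 * (17 * (√(2 * q) + 2 * q))) ≤
      1088 * K ^ 2 * (√q + q) * opNorm (covMatrix P₀ X) := by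
    have hsqrt : √(2 * q) ≤ 2 * √q := by
      rw [Real.sqrt_mul zero_le_two]
      gcongr
      exact Real.sqrt_le_self_iff.2 (Or.inr one_le_two)
    have hnorm : 0 ≤ opNorm (covMatrix P₀ X) := norm_nonneg _
    rw [mul_pow, Real.sq_sqrt hnorm]
    calc 32 * (K ^ 2 * opNorm (covMatrix P₀ X) * (17 * (√(2 * q) + 2 * q)))
        ≤ 32 * (K ^ 2 * opNorm (covMatrix P₀ X) * (17 * (2 * √q + 2 * q))) := by gcongr
      _ = 1088 * K ^ 2 * (√q + q) * opNorm (covMatrix P₀ X) := by ring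
  set good := {ω | opNorm (sampleCov (fun i => Xs i ω) - covMatrix P₀ X) ≤
    1088 * K ^ 2 * (√q + q) * opNorm (covMatrix P₀ X)}
  have hcompl : P.real goodᶜ ≤ 2 * Real.exp (-u) :=
    ((measureReal_mono fun ω hω => hthreshold.trans_lt (not_le.1 hω)).trans hbad).trans hprob
  have hcover : 1 ≤ P.real good + P.real goodᶜ := by
    rw [← probReal_univ (μ := P), ← Set.union_compl_self good]
    exact measureReal_union_le _ _
  linarith

end Concentration

section Gaussian

variable {n : ℕ} {μ : EuclideanSpace ℝ (Fin n)} {S : Matrix (Fin n) (Fin n) ℝ}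

lemma map_const_add_multivariateGaussian (ν : EuclideanSpace ℝ (Fin n)) :
    (multivariateGaussian μ S).map (ν + ·) = multivariateGaussian (ν + μ) S := by
  rw [multivariateGaussian, multivariateGaussian,
    Measure.map_map (measurable_const_add ν) (by fun_prop)]
  simp only [Function.comp_def, add_assoc]

lemma memLp_eval_multivariateGaussian (i : Fin n) :
    MemLp (fun x : EuclideanSpace ℝ (Fin n) => x i) 2 (multivariateGaussian μ S) :=
  MemLp.eval_piLp IsGaussian.memLp_two_id i

lemma integrable_eval_mul_eval_multivariateGaussian (i j : Fin n) :
    Integrable (fun x : EuclideanSpace ℝ (Fin n) => x i * x j) (multivariateGaussian μ S) :=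
  (memLp_eval_multivariateGaussian i).integrable_mul (memLp_eval_multivariateGaussian j)

lemma integral_eval_multivariateGaussian (i : Fin n) :
    ∫ x : EuclideanSpace ℝ (Fin n), x i ∂(multivariateGaussian μ S) = μ i := by
  rw [← eval_integral_piLp fun j => (memLp_eval_multivariateGaussian j).integrable one_le_two,
    integral_id_multivariateGaussian]

lemma integral_eval_mul_eval_multivariateGaussian (hS : S.PosSemidef) (i j : Fin n) :
    ∫ x : EuclideanSpace ℝ (Fin n), x i * x j ∂(multivariateGaussian μ S) =
      μ i * μ j + S i j := by
  have hcov := covariance_eval_multivariateGaussian (μ := μ) hS i j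
  rw [covariance_eq_sub (memLp_eval_multivariateGaussian i) (memLp_eval_multivariateGaussian j),
    integral_eval_multivariateGaussian, integral_eval_multivariateGaussian] at hcov
  exact sub_eq_iff_eq_add'.1 hcov

end Gaussian

section Mixture

lemma map_restrict_preimage_of_indepFun {Ω α β : Type*} [MeasurableSpace Ω] [MeasurableSpace α]
    [MeasurableSpace β] {P : Measure Ω} {f : Ω → α} {g : Ω → β} (h : IndepFun f g P)
    (hg : AEMeasurable g P) {t : Set α} (ht : MeasurableSet t) :
    (P.restrict (f ⁻¹' t)).map g = P (f ⁻¹' t) • P.map g := by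
  ext s hs
  rw [Measure.map_apply_of_aemeasurable hg.restrict hs,
    Measure.restrict_apply₀ (hg.restrict.nullMeasurable hs), Set.inter_comm,
    h.measure_inter_preimage_eq_mul t s ht hs, Measure.smul_apply, smul_eq_mul,
    Measure.map_apply_of_aemeasurable hg hs]

lemma map_restrict_preimage_const_add {Ω α : Type*} [MeasurableSpace Ω] [MeasurableSpace α]
    {P : Measure Ω} {n : ℕ} {S : Matrix (Fin n) (Fin n) ℝ} {f : Ω → α}
    {g : Ω → EuclideanSpace ℝ (Fin n)} (h : IndepFun f g P)
    (hg : HasLaw g (multivariateGaussian 0 S) P) {t : Set α} (ht : MeasurableSet t)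
    (ν : EuclideanSpace ℝ (Fin n)) :
    (P.restrict (f ⁻¹' t)).map (fun ω => ν + g ω) = P (f ⁻¹' t) • multivariateGaussian ν S := by
  rw [← Function.comp_def (ν + ·) g, ← AEMeasurable.map_map_of_aemeasurable
      (measurable_const_add ν).aemeasurable hg.aemeasurable.restrict,
    map_restrict_preimage_of_indepFun h hg.aemeasurable ht, hg.map_eq, Measure.map_smul,
    map_const_add_multivariateGaussian, add_zero]

namespace IsMixture

variable {Ω : Type*} [MeasurableSpace Ω] {P : Measure Ω} {n : ℕ}
  {μ : EuclideanSpace ℝ (Fin n)} {S₁ S₂ : Matrix (Fin n) (Fin n) ℝ}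
  {θ : Ω → ℝ} {g₁ g₂ X : Ω → EuclideanSpace ℝ (Fin n)}

lemma ae_eq_restrict_pos (h : IsMixture P μ S₁ S₂ θ g₁ g₂ X) :
    X =ᵐ[P.restrict (θ ⁻¹' {1})] fun ω => μ + g₁ ω := by
  filter_upwards [ae_restrict_mem₀
    (h.aemeasurable_theta.nullMeasurable (measurableSet_singleton 1))] with ω hω
  have hθ : θ ω = 1 := hω
  rw [h.eq_mixture, if_pos hθ, hθ, one_smul]

lemma ae_eq_restrict_neg (h : IsMixture P μ S₁ S₂ θ g₁ g₂ X) :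
    X =ᵐ[P.restrict (θ ⁻¹' {-1})] fun ω => -μ + g₂ ω := by
  filter_upwards [ae_restrict_mem₀
    (h.aemeasurable_theta.nullMeasurable (measurableSet_singleton (-1)))] with ω hω
  have hθ : θ ω = -1 := hω
  rw [h.eq_mixture, hθ, if_neg (by norm_num), neg_one_smul]

variable [IsProbabilityMeasure P]

lemma restrict_add_restrict (h : IsMixture P μ S₁ S₂ θ g₁ g₂ X) :
    P.restrict (θ ⁻¹' {1}) + P.restrict (θ ⁻¹' {-1}) = P := by
  have hpos : NullMeasurableSet (θ ⁻¹' {1}) P :=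
    h.aemeasurable_theta.nullMeasurable (measurableSet_singleton 1)
  have hneg : NullMeasurableSet (θ ⁻¹' {-1}) P :=
    h.aemeasurable_theta.nullMeasurable (measurableSet_singleton (-1))
  have hdisj : Disjoint (θ ⁻¹' {1}) (θ ⁻¹' {-1}) :=
    Disjoint.preimage θ (Set.disjoint_singleton.2 (by norm_num))
  have hunion : P (θ ⁻¹' {1} ∪ θ ⁻¹' {-1}) = 1 := by
    rw [measure_union₀ hneg hdisj.aedisjoint]
    exact (congrArg₂ (· + ·) h.theta_pos h.theta_neg).trans (ENNReal.add_halves 1)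
  rw [← Measure.restrict_union₀ hdisj.aedisjoint hneg]
  exact Measure.restrict_eq_self_of_ae_mem ((prob_compl_eq_zero_iff₀ (hpos.union hneg)).2 hunion)

lemma hasLaw (h : IsMixture P μ S₁ S₂ θ g₁ g₂ X) :
    HasLaw X ((1 / 2 : ℝ≥0∞) • multivariateGaussian μ S₁ +
      (1 / 2 : ℝ≥0∞) • multivariateGaussian (-μ) S₂) P := by
  have hpos := (h.law₁.aemeasurable.const_add μ).restrict (s := θ ⁻¹' {1}) |>.congr
    h.ae_eq_restrict_pos.symm
  have hneg := (h.law₂.aemeasurable.const_add (-μ)).restrict (s := θ ⁻¹' {-1}) |>.congr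
    h.ae_eq_restrict_neg.symm
  refine ⟨h.restrict_add_restrict ▸ hpos.add_measure hneg, ?_⟩
  rw [← h.restrict_add_restrict, AEMeasurable.map_add₀ hpos hneg,
    Measure.map_congr h.ae_eq_restrict_pos, Measure.map_congr h.ae_eq_restrict_neg,
    map_restrict_preimage_const_add h.indep₁ h.law₁ (measurableSet_singleton 1) μ,
    map_restrict_preimage_const_add h.indep₂ h.law₂ (measurableSet_singleton (-1)) (-μ)]
  exact congrArg₂ (fun a b : ℝ≥0∞ => a • multivariateGaussian μ S₁ +
    b • multivariateGaussian (-μ) S₂) h.theta_pos h.theta_neg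

lemma memLp_two (h : IsMixture P μ S₁ S₂ θ g₁ g₂ X) : MemLp X 2 P := by
  have hint : ∀ (ν : EuclideanSpace ℝ (Fin n)) (S : Matrix (Fin n) (Fin n) ℝ),
      Integrable (fun x => ‖x‖ ^ 2) ((1 / 2 : ℝ≥0∞) • multivariateGaussian ν S) := fun ν S =>
    ((memLp_two_iff_integrable_sq_norm aestronglyMeasurable_id).1
      IsGaussian.memLp_two_id).smul_measure (by norm_num)
  refine (memLp_map_measure_iff aestronglyMeasurable_id h.hasLaw.aemeasurable).1 ?_
  rw [h.hasLaw.map_eq, memLp_two_iff_integrable_sq_norm aestronglyMeasurable_id]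
  exact (hint μ S₁).add_measure (hint (-μ) S₂)

lemma covMatrix_eq (h : IsMixture P μ S₁ S₂ θ g₁ g₂ X) (hS₁ : S₁.PosSemidef)
    (hS₂ : S₂.PosSemidef) :
    covMatrix P X = Matrix.vecMulVec μ.ofLp μ.ofLp + (1 / 2 : ℝ) • (S₁ + S₂) := by
  ext i j
  have hmoment := h.hasLaw.integral_comp (f := fun x => x i * x j)
    (Continuous.aestronglyMeasurable (by fun_prop))
  have hhalf : (1 / 2 : ℝ≥0∞) ≠ ∞ := by norm_num
  rw [integral_add_measure
      ((integrable_eval_mul_eval_multivariateGaussian i j).smul_measure hhalf)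
      ((integrable_eval_mul_eval_multivariateGaussian i j).smul_measure hhalf),
    integral_smul_measure, integral_smul_measure, integral_eval_mul_eval_multivariateGaussian hS₁,
    integral_eval_mul_eval_multivariateGaussian hS₂] at hmoment
  refine hmoment.trans ?_
  simp only [one_div, ENNReal.toReal_inv, ENNReal.toReal_ofNat, smul_eq_mul, PiLp.neg_apply,
    mul_neg, neg_mul, neg_neg, smul_add, Matrix.add_apply, Matrix.vecMulVec_apply,
    Matrix.smul_apply]
  ring

lemma opNorm_covMatrix_le (h : IsMixture P μ S₁ S₂ θ g₁ g₂ X) (hn : 0 < n)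
    (hS₁ : S₁.PosSemidef) (hS₂ : S₂.PosSemidef) :
    opNorm (covMatrix P X) ≤
      (lambda1 hn hS₁.isHermitian + lambda1 hn hS₂.isHermitian) / 2 + ‖μ‖ ^ 2 := by
  have hsum := opNorm_add_le S₁ S₂
  have hle₁ := opNorm_le_lambda1 hn hS₁
  have hle₂ := opNorm_le_lambda1 hn hS₂
  calc opNorm (covMatrix P X)
      ≤ opNorm (Matrix.vecMulVec μ.ofLp μ.ofLp) + opNorm ((1 / 2 : ℝ) • (S₁ + S₂)) := by
        rw [h.covMatrix_eq hS₁ hS₂]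
        exact opNorm_add_le _ _
    _ = ‖μ‖ ^ 2 + 1 / 2 * opNorm (S₁ + S₂) := by
        rw [opNorm_vecMulVec_self, opNorm_smul, abs_of_pos one_half_pos]
    _ ≤ (lambda1 hn hS₁.isHermitian + lambda1 hn hS₂.isHermitian) / 2 + ‖μ‖ ^ 2 := by linarith

end IsMixture

end Mixture

end AllometricMixture

theorem mainTheorem4_general :
    ∃ C : ℝ, 0 < C ∧
      ∀ (n m : ℕ) (hn : 0 < n), 0 < m →
      ∀ (μ : EuclideanSpace ℝ (Fin n)) (S₁ S₂ : Matrix (Fin n) (Fin n) ℝ)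
        (hS₁ : S₁.PosSemidef) (hS₂ : S₂.PosSemidef)
        {Ω₀ : Type*} [MeasurableSpace Ω₀] (P₀ : Measure Ω₀) [IsProbabilityMeasure P₀]
        (θ : Ω₀ → ℝ) (g₁ g₂ X : Ω₀ → EuclideanSpace ℝ (Fin n)),
        AllometricMixture.IsMixture P₀ μ S₁ S₂ θ g₁ g₂ X →
      ∀ K : ℝ, 0 ≤ K →
        (∀ x : EuclideanSpace ℝ (Fin n),
          AllometricMixture.psi2Norm (fun ω => ⟪X ω, x⟫) P₀ ≤
            ENNReal.ofReal K * eLpNorm (fun ω => ⟪X ω, x⟫) 2 P₀) →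
      ∀ {Ω : Type*} [MeasurableSpace Ω] (P : Measure Ω) [IsProbabilityMeasure P]
        (Xs : Fin m → Ω → EuclideanSpace ℝ (Fin n)),
        iIndepFun Xs P → (∀ i, IdentDistrib (Xs i) X P P₀) →
      ∀ u : ℝ, 0 ≤ u →
        1 - 2 * Real.exp (-u) ≤
          P.real {ω |
            AllometricMixture.opNorm (AllometricMixture.sampleCov (fun i => Xs i ω) -
                AllometricMixture.covMatrix P₀ X) ≤
              C * K ^ 2 * (√((n + u) / m) + (n + u) / m) *
                ((AllometricMixture.lambda1 hn hS₁.isHermitian +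
                  AllometricMixture.lambda1 hn hS₂.isHermitian) / 2 + ‖μ‖ ^ 2)} := by
  refine ⟨1088, by norm_num, ?_⟩
  intro n m hn hm μ S₁ S₂ hS₁ hS₂ Ω₀ _ P₀ _ θ g₁ g₂ X hX K hK hpsi Ω _ P _ Xs hind hid u hu
  refine (AllometricMixture.le_measureReal_opNorm_sampleCov_sub_covMatrix_le hm hX.memLp_two hind
    hid hK hpsi hu).trans (measureReal_mono fun ω hω => ?_)
  rw [Set.mem_ofPred_eq] at hω ⊢
  refine hω.trans ?_
  gcongr
  exact hX.opNorm_covMatrix_le hn hS₁ hS₂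

theorem mainTheorem4 :
    ∃ C : ℝ, 0 < C ∧
      ∀ (n m : ℕ) (hn : 0 < n), 0 < m →
      ∀ (μ : EuclideanSpace ℝ (Fin n)) (S₁ S₂ : Matrix (Fin n) (Fin n) ℝ)
        (hA : AllometricMixture.IsAllometric hn μ S₁ S₂)
        -- the population variable `X = θ μ + g^(θ)`
        {Ω₀ : Type*} [MeasurableSpace Ω₀] (P₀ : Measure Ω₀) [IsProbabilityMeasure P₀]
        (θ : Ω₀ → ℝ) (g₁ g₂ X : Ω₀ → EuclideanSpace ℝ (Fin n)),
        AllometricMixture.IsMixture P₀ μ S₁ S₂ θ g₁ g₂ X →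
      -- the constant in the sub-gaussian property of `X`
      ∀ K : ℝ, 1 ≤ K →
        (∀ x : EuclideanSpace ℝ (Fin n),
          AllometricMixture.psi2Norm (fun ω => ⟪X ω, x⟫) P₀ ≤
            ENNReal.ofReal K * eLpNorm (fun ω => ⟪X ω, x⟫) 2 P₀) →
      -- the sample: `m` independent copies of `X`
      ∀ {Ω : Type*} [MeasurableSpace Ω] (P : Measure Ω) [IsProbabilityMeasure P]
        (Xs : Fin m → Ω → EuclideanSpace ℝ (Fin n)),
        iIndepFun Xs P → (∀ i, IdentDistrib (Xs i) X P P₀) →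
      ∀ u : ℝ, 0 ≤ u →
        1 - 2 * Real.exp (-u) ≤
          P.real {ω |
            AllometricMixture.opNorm (AllometricMixture.sampleCov (fun i => Xs i ω) -
                AllometricMixture.covMatrix P₀ X) ≤
              C * K ^ 2 * (√((n + u) / m) + (n + u) / m) *
                ((AllometricMixture.lambda1 hn hA.posDef₁.isHermitian +
                  AllometricMixture.lambda1 hn hA.posDef₂.isHermitian) / 2 + ‖μ‖ ^ 2)} := by
  obtain ⟨C, hC, h⟩ := mainTheorem4_general
  exact ⟨C, hC, fun n m hn hm μ S₁ S₂ hA _ _ P₀ _ θ g₁ g₂ X hX K hK =>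
    h n m hn hm μ S₁ S₂ hA.posDef₁.posSemidef hA.posDef₂.posSemidef P₀ θ g₁ g₂ X hX K
      (zero_le_one.trans hK)⟩
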